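/- Let $d$ be a nonnegative integer, let $S$ be a finite set of points in $\mathbb{R}^d$, and let $z \in \mathbb{R}^d \setminus S$. Call a set $X \subseteq S$ *$z$-containing* if $z$ lies in the interior of the convex hull of $X$, and *$z$-avoiding* otherwise. Let $\mathcal{C}(S)$ be the family of minimal $z$-containing subsets of $S$, that is, the $z$-containing $X \subseteq S$ with no proper $z$-containing subset. Let $\mathcal{A}(S)$ be the family of maximal $z$-avoiding subsets of $S$, that is, the $z$-avoiding $X \subseteq S$ that are not properly contained in any $z$-avoiding subset of $S$. Say that $z$ is in general position with respect to $S$ if, for every $X \subseteq S$ whose affine hull has dimension less than $d$, the point $z$ does not lie in the affine hull of $X$. Suppose that $S$ is $z$-containing, that $z$ is in general position with respect to $S$, and that $|S| \ge d+2$. Then $$|\mathcal{A}(S)| \le d\,|\mathcal{C}(S)| - |S| + 3.$$ -/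

import Mathlib

namespace ContainAvoid

/-- `X` is `z`-containing: `z` lies in the interior of the convex hull of `X`. -/
def IsContaining {d : ℕ} (z : EuclideanSpace ℝ (Fin d))
    (X : Finset (EuclideanSpace ℝ (Fin d))) : Prop :=
  z ∈ interior (convexHull ℝ (X : Set (EuclideanSpace ℝ (Fin d))))

/-- `X` is `z`-avoiding: `z` does not lie in the interior of the convex hull of `X`. -/
def IsAvoiding {d : ℕ} (z : EuclideanSpace ℝ (Fin d))
    (X : Finset (EuclideanSpace ℝ (Fin d))) : Prop :=
  z ∉ interior (convexHull ℝ (X : Set (EuclideanSpace ℝ (Fin d))))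

/-- `X` is `z`-containing and has no proper `z`-containing subset. -/
def IsMinimalContaining {d : ℕ} (z : EuclideanSpace ℝ (Fin d))
    (X : Finset (EuclideanSpace ℝ (Fin d))) : Prop :=
  IsContaining z X ∧ ∀ Y, Y ⊂ X → ¬ IsContaining z Y

/-- `X` is a `z`-avoiding subset of `S` that is not properly contained in any
`z`-avoiding subset of `S`. -/
def IsMaximalAvoiding {d : ℕ} (z : EuclideanSpace ℝ (Fin d))
    (S X : Finset (EuclideanSpace ℝ (Fin d))) : Prop :=
  X ⊆ S ∧ IsAvoiding z X ∧ ∀ Y, Y ⊆ S → X ⊂ Y → ¬ IsAvoiding z Y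

open Classical in
/-- The family `C(S)` of minimal `z`-containing subsets of `S`. -/
noncomputable def minContaining {d : ℕ} (z : EuclideanSpace ℝ (Fin d))
    (S : Finset (EuclideanSpace ℝ (Fin d))) : Finset (Finset (EuclideanSpace ℝ (Fin d))) :=
  S.powerset.filter (fun X => IsMinimalContaining z X)

open Classical in
/-- The family `A(S)` of maximal `z`-avoiding subsets of `S`. -/
noncomputable def maxAvoiding {d : ℕ} (z : EuclideanSpace ℝ (Fin d))
    (S : Finset (EuclideanSpace ℝ (Fin d))) : Finset (Finset (EuclideanSpace ℝ (Fin d))) :=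
  S.powerset.filter (fun X => IsMaximalAvoiding z S X)

/-- `z` is in general position with respect to `S`: it lies in no affine subspace of dimension
less than `d` that is spanned by a subset of `S`. (The affine span of the empty set is empty, so
the value of its dimension does not matter.) -/
def InGeneralPosition {d : ℕ} (z : EuclideanSpace ℝ (Fin d))
    (S : Finset (EuclideanSpace ℝ (Fin d))) : Prop :=
  ∀ X : Finset (EuclideanSpace ℝ (Fin d)), X ⊆ S →
    Module.finrank ℝ (affineSpan ℝ (X : Set (EuclideanSpace ℝ (Fin d)))).direction < d →
      z ∉ affineSpan ℝ (X : Set (EuclideanSpace ℝ (Fin d)))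

end ContainAvoid

/-! By Carathéodory and general position, the minimal `z`-containing sets are exactly the
`(d+1)`-point simplices around `z`. Write `a` for the number of maximal avoiders, `c` for the number
of simplices and `k` for the number of points common to all simplices.

The main step is a double count. For a maximal avoider `A` and `x ∈ S \ A`, some simplex in `A ∪
{x}` has its barycentric coordinate at `x` nonpositive on `A`. This coordinate is positive at `z`,
so it separates `z` from `A`. Two avoiders assigned the same simplex at the same `x` lie in one
halfspace missing `z`, so their union avoids `z` and they coincide by maximality. Hence `(A, x)`
injects into pairs of a simplex and one of its vertices. At most `k` avoiders miss a common point,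
and every other avoider misses at least two points of `S`, so `2a ≤ 2k + (d+1-k)c`
(`two_mul_card_add_le`).

Pivoting gives `|S| ≤ c + d` (`card_le`), and the two bounds suffice when `d + k ≥ 3`. For `d = 1` a
direct argument gives `a ≤ 2` (`card_le_two`). For `d = 2`, `k = 0`, the sharper bound `2|S| ≤ c +
2d + 2` is needed (`star_or_card_le`). -/

namespace ContainAvoid

/-! ### Counting in families with the exchange property -/

section Combinatorics

variable {α : Type*} [DecidableEq α]

/-- The combinatorial properties of the simplices with vertices in `S` that contain a point in
general position: they have `d + 1` vertices, every point of `S` can be exchanged into each of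
them, and whenever a `d`-set `D ⊆ T` spans such a simplex with every other point of `T`,
all simplices in `T` contain `D`. -/
structure PivotFamily (S : Finset α) (d : ℕ) (𝒞 : Finset (Finset α)) : Prop where
  subset : ∀ C ∈ 𝒞, C ⊆ S
  card_eq : ∀ C ∈ 𝒞, C.card = d + 1
  exchange : ∀ C ∈ 𝒞, ∀ x ∈ S, x ∉ C → ∃ c ∈ C, insert x (C.erase c) ∈ 𝒞
  star : ∀ T ⊆ S, ∀ D ⊆ T, D.card = d → (∀ y ∈ T, y ∉ D → insert y D ∈ 𝒞) →
    ∀ C ∈ 𝒞, C ⊆ T → D ⊆ C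

namespace PivotFamily

variable {S : Finset α} {d : ℕ} {𝒞 : Finset (Finset α)}

/-- Exchanging each `x ∉ C₀` into a fixed `C₀` gives distinct members other than `C₀`, since `x` is
the only new point. -/
theorem card_le (h : PivotFamily S d 𝒞) (hne : 𝒞.Nonempty) : S.card ≤ 𝒞.card + d := by
  obtain ⟨C₀, hC₀⟩ := hne
  have hex : ∀ x, ∃ c, x ∈ S → x ∉ C₀ → c ∈ C₀ ∧ insert x (C₀.erase c) ∈ 𝒞 := by
    intro x
    by_cases hx : x ∈ S ∧ x ∉ C₀
    · obtain ⟨c, hc⟩ := h.exchange C₀ hC₀ x hx.1 hx.2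
      exact ⟨c, fun _ _ => hc⟩
    · exact ⟨x, fun h1 h2 => absurd ⟨h1, h2⟩ hx⟩
  choose c hc using hex
  have h1 : (S \ C₀).card ≤ (𝒞.erase C₀).card := by
    refine Finset.card_le_card_of_injOn (fun x => insert x (C₀.erase (c x))) ?_ ?_
    · intro x hx
      simp only [Finset.coe_sdiff, Set.mem_sdiff, Finset.mem_coe] at hx
      simp only [Finset.coe_erase, Set.mem_sdiff, Finset.mem_coe, Set.mem_singleton_iff]
      refine ⟨(hc x hx.1 hx.2).2, fun he => hx.2 ?_⟩
      rw [← he]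
      exact Finset.mem_insert_self _ _
    · intro x hx y hy hxy
      simp only [Finset.coe_sdiff, Set.mem_sdiff, Finset.mem_coe] at hx hy
      have : x ∈ insert y (C₀.erase (c y)) := by
        rw [← show insert x (C₀.erase (c x)) = insert y (C₀.erase (c y)) from hxy]
        exact Finset.mem_insert_self _ _
      rcases Finset.mem_insert.1 this with h | h
      · exact h
      · exact absurd (Finset.mem_of_mem_erase h) hx.2
  have h2 := Finset.card_sdiff_add_card_eq_card (h.subset C₀ hC₀)
  have h3 := h.card_eq C₀ hC₀
  have h4 := Finset.card_erase_add_one hC₀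
  omega

/-- Induction deletes a point `x` outside some member. If at least two members contain `x`, the
bound passes from `T.erase x` to `T`; the cases of a single such member, or of a common `d`-set in
`T.erase x`, are treated separately. -/
theorem star_or_card_le (h : PivotFamily S d 𝒞) (n : ℕ) : ∀ T ⊆ S, T.card = n →
    (𝒞.filter (· ⊆ T)).Nonempty →
    (∃ D : Finset α, D.card = d ∧ ∀ C ∈ 𝒞, C ⊆ T → D ⊆ C) ∨
      2 * T.card ≤ (𝒞.filter (· ⊆ T)).card + 2 * d + 2 := by
  induction n with
  | zero =>
    intro T _ hT ⟨C, hC⟩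
    rw [Finset.mem_filter] at hC
    have h1 := h.card_eq C hC.1
    have h2 := Finset.card_le_card hC.2
    omega
  | succ n ih =>
    intro T hTS hT ⟨C₀, hC₀⟩
    rw [Finset.mem_filter] at hC₀
    obtain ⟨hC₀, hC₀T⟩ := hC₀
    have hC₀c := h.card_eq C₀ hC₀
    by_cases hTC : T ⊆ C₀
    · obtain ⟨y, hy⟩ : C₀.Nonempty := by rw [← Finset.card_pos]; omega
      refine Or.inl ⟨C₀.erase y, by rw [Finset.card_erase_of_mem hy]; omega, fun C hC hCT => ?_⟩
      have : C = C₀ := Finset.eq_of_subset_of_card_le (hCT.trans hTC)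
        (by rw [h.card_eq C hC, hC₀c])
      rw [this]
      exact Finset.erase_subset _ _
    obtain ⟨x, hxT, hxC₀⟩ := Finset.not_subset.1 hTC
    have hT'S : T.erase x ⊆ S := (Finset.erase_subset _ _).trans hTS
    have hT'c : (T.erase x).card = n := by rw [Finset.card_erase_of_mem hxT]; omega
    have hC₀T' : C₀ ⊆ T.erase x := Finset.subset_erase.2 ⟨hC₀T, hxC₀⟩
    have hsub : ∀ C : Finset α, C ⊆ T.erase x ↔ C ⊆ T ∧ x ∉ C := fun C => Finset.subset_erase
    set N := 𝒞.filter (fun C => C ⊆ T ∧ x ∈ C) with hN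
    have hsplit : (𝒞.filter (· ⊆ T)).card = (𝒞.filter (· ⊆ T.erase x)).card + N.card := by
      rw [← Finset.card_filter_add_card_filter_not (s := 𝒞.filter (· ⊆ T)) (fun C => x ∉ C),
        Finset.filter_filter, Finset.filter_filter]
      simp only [hsub, not_not, hN]
    have hexT : ∀ C ∈ 𝒞, C ⊆ T → ∀ y ∈ T, y ∉ C →
        ∃ c ∈ C, insert y (C.erase c) ∈ 𝒞 ∧ insert y (C.erase c) ⊆ T := by
      intro C hC hCT y hy hyC
      obtain ⟨c, hc, hcC⟩ := h.exchange C hC y (hTS hy) hyC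
      exact ⟨c, hc, hcC, Finset.insert_subset hy ((Finset.erase_subset _ _).trans hCT)⟩
    have hNne : N.Nonempty := by
      obtain ⟨c, hc, h1, h2⟩ := hexT C₀ hC₀ hC₀T x hxT hxC₀
      exact ⟨_, Finset.mem_filter.2 ⟨h1, h2, Finset.mem_insert_self _ _⟩⟩
    rcases ih (T.erase x) hT'S hT'c ⟨C₀, Finset.mem_filter.2 ⟨hC₀, hC₀T'⟩⟩ with
      ⟨D, hDc, hD⟩ | hlarge
    · have hDC₀ := hD C₀ hC₀ hC₀T'
      have hDT' := hDC₀.trans hC₀T'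
      have hxD : x ∉ D := fun hx => hxC₀ (hDC₀ hx)
      have hyD : ∀ y ∈ T.erase x, y ∉ D → insert y D ∈ 𝒞 := by
        intro y hy hyD
        obtain ⟨C, hC, hCT, hyC⟩ : ∃ C ∈ 𝒞, C ⊆ T.erase x ∧ y ∈ C := by
          by_cases hyC₀ : y ∈ C₀
          · exact ⟨C₀, hC₀, hC₀T', hyC₀⟩
          · obtain ⟨c, hc, h1⟩ := h.exchange C₀ hC₀ y (hT'S hy) hyC₀
            exact ⟨_, h1, Finset.insert_subset hy ((Finset.erase_subset _ _).trans hC₀T'),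
              Finset.mem_insert_self _ _⟩
        have : insert y D = C := Finset.eq_of_subset_of_card_le
          (Finset.insert_subset hyC (hD C hC hCT))
          (by rw [h.card_eq C hC, Finset.card_insert_of_notMem hyD, hDc])
        rwa [this]
      by_cases hxDC : insert x D ∈ 𝒞
      -- Now `D` forms a member with every other point of `T`, so the star property applies.
      · refine Or.inl ⟨D, hDc, h.star T hTS D (hDT'.trans (Finset.erase_subset _ _)) hDc ?_⟩
        intro y hy hyD'
        by_cases hyx : y = x
        · rwa [hyx]
        · exact hyD y (Finset.mem_erase.2 ⟨hyx, hy⟩) hyD'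
      · right
        have hcard := Finset.card_sdiff_add_card_eq_card hDT'
        have h1 : (T.erase x \ D).card ≤ (𝒞.filter (· ⊆ T.erase x)).card := by
          refine Finset.card_le_card_of_injOn (fun y => insert y D) ?_ ?_
          · intro y hy
            have hy := Finset.mem_sdiff.1 (Finset.mem_coe.1 hy)
            exact Finset.mem_coe.2 (Finset.mem_filter.2
              ⟨hyD y hy.1 hy.2, Finset.insert_subset hy.1 hDT'⟩)
          · intro y hy y' hy' he
            have hy := Finset.mem_sdiff.1 (Finset.mem_coe.1 hy)
            have : y ∈ insert y' D := by
              rw [← show insert y D = insert y' D from he]; exact Finset.mem_insert_self _ _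
            exact (Finset.mem_insert.1 this).resolve_right hy.2
        -- Exchanging `x` into `insert y D` cannot drop `y`, as `insert x D` is not a member. The
        -- result contains `x` and `y` and otherwise only points of `D`, so it determines `y`.
        have h2 : (T.erase x \ D).card ≤ N.card := by
          have hex : ∀ y, ∃ E, y ∈ T.erase x → y ∉ D → E ∈ N ∧ y ∈ E ∧
              E ⊆ insert x (insert y D) := by
            intro y
            by_cases hy : y ∈ T.erase x ∧ y ∉ D
            · have hyT := Finset.mem_erase.1 hy.1
              obtain ⟨c, hc, h1, h2⟩ := hexT _ (hyD y hy.1 hy.2)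
                (Finset.insert_subset hyT.2 (hDT'.trans (Finset.erase_subset _ _))) x hxT
                (by simp [hxD, Ne.symm hyT.1])
              refine ⟨_, fun _ _ => ⟨Finset.mem_filter.2 ⟨h1, h2, Finset.mem_insert_self _ _⟩,
                ?_, Finset.insert_subset_insert _ (Finset.erase_subset _ _)⟩⟩
              have hcy : c ≠ y := by
                rintro rfl
                rw [Finset.erase_insert hy.2] at h1
                exact hxDC h1
              simp [hcy.symm]
            · exact ⟨∅, fun h1 h2 => absurd ⟨h1, h2⟩ hy⟩
          choose E hE using hex
          refine Finset.card_le_card_of_injOn E ?_ ?_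
          · intro y hy
            have hy := Finset.mem_sdiff.1 (Finset.mem_coe.1 hy)
            exact (hE y hy.1 hy.2).1
          · intro y hy y' hy' he
            have hy := Finset.mem_sdiff.1 (Finset.mem_coe.1 hy)
            have hy' := Finset.mem_sdiff.1 (Finset.mem_coe.1 hy')
            have h1 := (hE y hy.1 hy.2).2.1
            rw [he] at h1
            have h2 := (hE y' hy'.1 hy'.2).2.2 h1
            simp only [Finset.mem_insert] at h2
            rcases h2 with h2 | h2 | h2
            · exact absurd h2 (Finset.mem_erase.1 hy.1).1
            · exact h2
            · exact absurd h2 hy.2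
        omega
    · by_cases hN2 : 2 ≤ N.card
      · right; omega
      · left
        have hN1 : N.card = 1 := by
          have := hNne.card_pos
          omega
        obtain ⟨E, hE⟩ := Finset.card_eq_one.1 hN1
        have hEN : E ∈ N := by rw [hE]; exact Finset.mem_singleton_self _
        have huniq : ∀ C ∈ 𝒞, C ⊆ T → x ∈ C → C = E := by
          intro C h1 h2 h3
          have : C ∈ N := Finset.mem_filter.2 ⟨h1, h2, h3⟩
          rwa [hE, Finset.mem_singleton] at this
        obtain ⟨hE1, -, hxE⟩ := Finset.mem_filter.1 hEN
        -- Exchanging `x` into any member must produce the unique `E`, so that member includes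
        -- `E.erase x`.
        refine ⟨E.erase x, by rw [Finset.card_erase_of_mem hxE, h.card_eq E hE1]; rfl, ?_⟩
        intro C hC hCT
        by_cases hxC : x ∈ C
        · rw [huniq C hC hCT hxC]
          exact Finset.erase_subset _ _
        · obtain ⟨c, hc, h1, h2⟩ := hexT C hC hCT x hxT hxC
          rw [← huniq _ h1 h2 (Finset.mem_insert_self _ _), Finset.erase_insert
            (fun hx => hxC (Finset.mem_of_mem_erase hx))]
          exact Finset.erase_subset _ _

/-- The members of `𝒜` are maximal among the subsets of `S` that include no member of `𝒞`, and
a member `A` can be recovered from a point `x ∉ A` and the set `φ A x ∈ 𝒞`. -/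
structure MaximalAvoiders (S : Finset α) (𝒞 𝒜 : Finset (Finset α))
    (φ : Finset α → α → Finset α) : Prop where
  subset : ∀ A ∈ 𝒜, A ⊆ S
  avoid : ∀ A ∈ 𝒜, ∀ C ∈ 𝒞, ¬ C ⊆ A
  maximal : ∀ A ∈ 𝒜, ∀ X ⊆ S, (∀ C ∈ 𝒞, ¬ C ⊆ X) → A ⊆ X → A = X
  mem_family : ∀ A ∈ 𝒜, ∀ x ∈ S, x ∉ A → φ A x ∈ 𝒞
  mem_self : ∀ A ∈ 𝒜, ∀ x ∈ S, x ∉ A → x ∈ φ A x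
  subset_insert : ∀ A ∈ 𝒜, ∀ x ∈ S, x ∉ A → φ A x ⊆ insert x A
  injective : ∀ A ∈ 𝒜, ∀ A' ∈ 𝒜, ∀ x ∈ S, x ∉ A → x ∉ A' → φ A x = φ A' x → A = A'

theorem two_mul_card_add_le (h : PivotFamily S d 𝒞) (hne : 𝒞.Nonempty)
    {𝒜 : Finset (Finset α)} {φ : Finset α → α → Finset α} (hA : MaximalAvoiders S 𝒞 𝒜 φ)
    {K : Finset α} (hK : K = S.filter (fun x => ∀ C ∈ 𝒞, x ∈ C)) :
    2 * 𝒜.card + K.card * 𝒞.card ≤ 2 * K.card + (d + 1) * 𝒞.card := by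
  have hKC : ∀ C ∈ 𝒞, K ⊆ C := by
    intro C hC x hx
    rw [hK, Finset.mem_filter] at hx
    exact hx.2 C hC
  have hKA : ∀ A ∈ 𝒜, ∀ x ∈ K, x ∉ A → A = S.erase x := by
    intro A hAA x hx hxA
    refine hA.maximal A hAA _ (Finset.erase_subset _ _) (fun C hC hCx => ?_)
      (Finset.subset_erase.2 ⟨hA.subset A hAA, hxA⟩)
    exact (Finset.subset_erase.1 hCx).2 (hKC C hC hx)
  set 𝒜₁ := 𝒜.filter (fun A => K ⊆ A) with h𝒜₁
  set 𝒜₀ := 𝒜.filter (fun A => ¬ K ⊆ A) with h𝒜₀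
  have hsum : 𝒜₁.card + 𝒜₀.card = 𝒜.card :=
    Finset.card_filter_add_card_filter_not _
  have h0 : 𝒜₀.card ≤ K.card := by
    have : 𝒜₀ ⊆ K.image (fun x => S.erase x) := by
      intro A hA0
      obtain ⟨hAA, hKA'⟩ := Finset.mem_filter.1 hA0
      obtain ⟨x, hx, hxA⟩ := Finset.not_subset.1 hKA'
      exact Finset.mem_image.2 ⟨x, hx, (hKA A hAA x hx hxA).symm⟩
    exact (Finset.card_le_card this).trans Finset.card_image_le
  have hlow : 2 * 𝒜₁.card ≤ (𝒜₁.sigma (fun A => S \ A)).card := by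
    rw [Finset.card_sigma, mul_comm, ← smul_eq_mul]
    refine Finset.card_nsmul_le_sum _ _ _ (fun A hA1 => ?_)
    -- If `A` missed only `x`, every member would have to contain `x`, so `x ∈ K ⊆ A`.
    obtain ⟨hAA, hKA'⟩ := Finset.mem_filter.1 hA1
    by_contra hlt
    push Not at hlt
    obtain ⟨C₀, hC₀⟩ := hne
    obtain ⟨x, hxC₀, hxA⟩ := Finset.not_subset.1 (hA.avoid A hAA C₀ hC₀)
    have hxS := h.subset C₀ hC₀ hxC₀
    have huniq : ∀ y ∈ S, y ∉ A → y = x := fun y hy hyA =>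
      Finset.card_le_one.1 (Nat.lt_succ_iff.1 hlt) y (Finset.mem_sdiff.2 ⟨hy, hyA⟩) x
        (Finset.mem_sdiff.2 ⟨hxS, hxA⟩)
    refine hxA (hKA' ?_)
    rw [hK, Finset.mem_filter]
    refine ⟨hxS, fun C hC => ?_⟩
    obtain ⟨y, hyC, hyA⟩ := Finset.not_subset.1 (hA.avoid A hAA C hC)
    rwa [← huniq y (h.subset C hC hyC) hyA]
  have hup : (𝒜₁.sigma (fun A => S \ A)).card ≤ (𝒞.sigma (fun C => C \ K)).card := by
    refine Finset.card_le_card_of_injOn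
      (fun p : (_ : Finset α) × α => (⟨φ p.1 p.2, p.2⟩ : (_ : Finset α) × α)) ?_ ?_
    · rintro ⟨A, x⟩ hp
      simp only [Finset.coe_sigma, Set.mem_sigma_iff, Finset.mem_coe, Finset.mem_sdiff] at hp ⊢
      obtain ⟨hA1, hxS, hxA⟩ := hp
      obtain ⟨hAA, hKA'⟩ := Finset.mem_filter.1 hA1
      exact ⟨hA.mem_family A hAA x hxS hxA, hA.mem_self A hAA x hxS hxA, fun hx => hxA (hKA' hx)⟩
    · rintro ⟨A, x⟩ hp ⟨A', x'⟩ hp' he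
      simp only [Finset.coe_sigma, Set.mem_sigma_iff, Finset.mem_coe, Finset.mem_sdiff] at hp hp'
      simp only [Sigma.mk.injEq, heq_eq_eq] at he
      obtain ⟨he, rfl⟩ := he
      have := hA.injective A (Finset.mem_filter.1 hp.1).1 A' (Finset.mem_filter.1 hp'.1).1 x
        hp.2.1 hp.2.2 hp'.2.2 he
      rw [this]
  have hcount : (𝒞.sigma (fun C => C \ K)).card + K.card * 𝒞.card = (d + 1) * 𝒞.card := by
    rw [Finset.card_sigma, mul_comm K.card, ← smul_eq_mul, ← Finset.sum_const,
      ← Finset.sum_add_distrib, mul_comm (d + 1), ← smul_eq_mul, ← Finset.sum_const]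
    refine Finset.sum_congr rfl (fun C hC => ?_)
    rw [Finset.card_sdiff_add_card_eq_card (hKC C hC), h.card_eq C hC]
  omega

/-- Each avoider misses a point of a fixed pair `C₀`, and a missed point `p` determines it: `p`
forms a member with every point of the avoider, so by the star property the union of two avoiders
missing `p` still avoids. -/
theorem card_le_two (h : PivotFamily S 1 𝒞) (hne : 𝒞.Nonempty)
    {𝒜 : Finset (Finset α)} {φ : Finset α → α → Finset α} (hA : MaximalAvoiders S 𝒞 𝒜 φ) :
    𝒜.card ≤ 2 := by
  obtain ⟨C₀, hC₀⟩ := hne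
  have hmiss : ∀ A ∈ 𝒜, ∃ p ∈ C₀, p ∉ A := fun A hAA =>
    Finset.not_subset.1 (hA.avoid A hAA C₀ hC₀)
  have hex : ∀ A, ∃ p, A ∈ 𝒜 → p ∈ C₀ ∧ p ∉ A := by
    intro A
    by_cases hAA : A ∈ 𝒜
    · obtain ⟨p, hp⟩ := hmiss A hAA
      exact ⟨p, fun _ => hp⟩
    · obtain ⟨p, hp⟩ : C₀.Nonempty := by
        rw [← Finset.card_pos, h.card_eq C₀ hC₀]; norm_num
      exact ⟨p, fun h => absurd h hAA⟩
  choose p hp using hex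
  have hnb : ∀ A ∈ 𝒜, ∀ x ∈ S, x ∉ A → ∀ a ∈ A, insert a {x} ∈ 𝒞 := by
    intro A hAA x hxS hxA a ha
    have hC := hA.mem_family A hAA x hxS hxA
    have hxC := hA.mem_self A hAA x hxS hxA
    have hCA := hA.subset_insert A hAA x hxS hxA
    have hax : a ≠ x := by rintro rfl; exact hxA ha
    obtain ⟨E, hE, hxE, haE⟩ : ∃ E ∈ 𝒞, x ∈ E ∧ a ∈ E := by
      by_cases haC : a ∈ φ A x
      · exact ⟨_, hC, hxC, haC⟩
      · obtain ⟨c, hc, h1⟩ := h.exchange _ hC a (hA.subset A hAA ha) haC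
        refine ⟨_, h1, ?_, Finset.mem_insert_self _ _⟩
        by_contra hx
        have hcx : c = x := by
          by_contra hcx
          exact hx (Finset.mem_insert_of_mem (Finset.mem_erase.2 ⟨Ne.symm hcx, hxC⟩))
        subst hcx
        -- If `x` were exchanged out, the new member would lie inside `A`.
        refine hA.avoid A hAA _ h1 (Finset.insert_subset ha ?_)
        intro y hy
        obtain ⟨hyc, hyC⟩ := Finset.mem_erase.1 hy
        exact (Finset.mem_insert.1 (hCA hyC)).resolve_left hyc
    have : insert a {x} = E := Finset.eq_of_subset_of_card_le
      (Finset.insert_subset haE (Finset.singleton_subset_iff.2 hxE))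
      (by rw [h.card_eq E hE, Finset.card_pair hax])
    rwa [this]
  rw [← show C₀.card = 2 from h.card_eq C₀ hC₀]
  refine Finset.card_le_card_of_injOn p (fun A hAA => (hp A hAA).1) ?_
  intro A hAA A' hAA' he
  have hAA := Finset.mem_coe.1 hAA
  have hAA' := Finset.mem_coe.1 hAA'
  have hxS := h.subset C₀ hC₀ (hp A hAA).1
  have hxA := (hp A hAA).2
  have hxA' := (hp A' hAA').2
  rw [← he] at hxA'
  have hU : A ∪ A' ⊆ S := Finset.union_subset (hA.subset A hAA) (hA.subset A' hAA')
  have hav : ∀ C ∈ 𝒞, ¬ C ⊆ A ∪ A' := by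
    intro C hC hCU
    have := h.star (insert (p A) (A ∪ A')) (Finset.insert_subset hxS hU) {p A}
      (Finset.singleton_subset_iff.2 (Finset.mem_insert_self _ _)) (Finset.card_singleton _)
      (by
        intro y hy hyx
        rcases Finset.mem_union.1 ((Finset.mem_insert.1 hy).resolve_left
          (fun h => hyx (Finset.mem_singleton.2 h))) with hyA | hyA
        · exact hnb A hAA _ hxS hxA y hyA
        · exact hnb A' hAA' _ hxS hxA' y hyA)
      C hC (hCU.trans (Finset.subset_insert _ _))
    rcases Finset.mem_union.1 (hCU (this (Finset.mem_singleton_self _))) with h1 | h1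
    · exact hxA h1
    · exact hxA' h1
  exact (hA.maximal A hAA _ hU hav Finset.subset_union_left).trans
    (hA.maximal A' hAA' _ hU hav Finset.subset_union_right).symm

theorem card_maximalAvoiders_le (h : PivotFamily S d 𝒞) (hne : 𝒞.Nonempty) (hd : 1 ≤ d)
    (hS : d + 2 ≤ S.card)
    {𝒜 : Finset (Finset α)} {φ : Finset α → α → Finset α} (hA : MaximalAvoiders S 𝒞 𝒜 φ) :
    (𝒜.card : ℤ) ≤ d * 𝒞.card - S.card + 3 := by
  have hc := h.card_le hne
  rcases hd.eq_or_lt with rfl | hd2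
  · have := h.card_le_two hne hA
    push_cast
    omega
  set K := S.filter (fun x => ∀ C ∈ 𝒞, x ∈ C) with hK
  have hcount := h.two_mul_card_add_le hne hA hK
  by_cases hdK : 3 ≤ d + K.card
  · zify at hcount hc hS hdK
    -- After substituting `|S| ≤ c + d`, twice the slack is at least `(d + k - 3)(c - 2)`, and `c ≥
    -- 2` because `|S| ≥ d + 2`.
    nlinarith [mul_nonneg (sub_nonneg.2 hdK) (show (0 : ℤ) ≤ 𝒞.card - 2 by linarith)]
  · have hd' : d = 2 := by omega
    have hK0 : K.card = 0 := by omega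
    subst hd'
    have hS' : 𝒞.filter (· ⊆ S) = 𝒞 := Finset.filter_true_of_mem h.subset
    rcases h.star_or_card_le _ S subset_rfl rfl (by rwa [hS']) with ⟨D, hDc, hD⟩ | hl
    · obtain ⟨C₀, hC₀⟩ := hne
      have hDK : D ⊆ K := fun x hx => Finset.mem_filter.2
        ⟨h.subset C₀ hC₀ (hD C₀ hC₀ (h.subset C₀ hC₀) hx),
          fun C hC => hD C hC (h.subset C hC) hx⟩
      have := Finset.card_le_card hDK
      omega
    · rw [hS'] at hl
      rw [hK0] at hcount
      push_cast
      omega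

end PivotFamily

end Combinatorics

end ContainAvoid

namespace ContainAvoid

/-! ### Simplices around a point in general position -/

section Geometry

theorem map_sum_smul {E : Type*} [AddCommGroup E] [Module ℝ E] (f : E →ᵃ[ℝ] ℝ) (s : Finset E)
    (w : E → ℝ) (hw : ∑ c ∈ s, w c = 1) : f (∑ c ∈ s, w c • c) = ∑ c ∈ s, w c * f c := by
  have hf : ∀ y, f y = f.linear y + f 0 := fun y => congrFun f.decomp y
  rw [hf, map_sum]
  conv_rhs => arg 2; ext c; rw [hf, mul_add]
  rw [Finset.sum_add_distrib, ← Finset.sum_mul, hw, one_mul]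
  simp

variable {d : ℕ} {z : EuclideanSpace ℝ (Fin d)} {S : Finset (EuclideanSpace ℝ (Fin d))}

theorem IsContaining.mono {X Y : Finset (EuclideanSpace ℝ (Fin d))} (hX : IsContaining z X)
    (h : X ⊆ Y) : IsContaining z Y :=
  interior_mono (convexHull_mono (Finset.coe_subset.2 h)) hX

theorem InGeneralPosition.exists_affineIndependent (hz : InGeneralPosition z S)
    {X : Finset (EuclideanSpace ℝ (Fin d))} (hX : X ⊆ S)
    (hzX : z ∈ convexHull ℝ (X : Set (EuclideanSpace ℝ (Fin d)))) :
    ∃ Y ⊆ X, Y.card = d + 1 ∧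
      AffineIndependent ℝ ((↑) : Y → EuclideanSpace ℝ (Fin d)) ∧
      z ∈ convexHull ℝ (Y : Set (EuclideanSpace ℝ (Fin d))) := by
  rw [convexHull_eq_union] at hzX
  simp only [Set.mem_iUnion] at hzX
  obtain ⟨Y, hYX, hY, hzY⟩ := hzX
  have hYX := Finset.coe_subset.1 hYX
  refine ⟨Y, hYX, ?_, hY, hzY⟩
  have hpos : 0 < Y.card := by
    rw [Finset.card_pos]
    have := convexHull_nonempty_iff.1 ⟨z, hzY⟩
    exact this
  have hfr := hY.finrank_vectorSpan (n := Y.card - 1) (by rw [Fintype.card_coe]; omega)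
  have hle := Submodule.finrank_le (vectorSpan ℝ (Y : Set (EuclideanSpace ℝ (Fin d))))
  rw [finrank_euclideanSpace_fin] at hle
  have hnot := mt (hz Y (hYX.trans hX)) (not_not.2 (convexHull_subset_affineSpan _ hzY))
  rw [direction_affineSpan] at hnot
  rw [show Set.range ((↑) : Y → EuclideanSpace ℝ (Fin d)) = Y from Subtype.range_coe] at hfr
  omega

/-- `g c` is, for `c ∈ C`, the barycentric coordinate at `c` with respect to an affine basis `C`
whose simplex contains `z` in its interior. -/
structure IsBarycentric (z : EuclideanSpace ℝ (Fin d))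
    (C : Finset (EuclideanSpace ℝ (Fin d)))
    (g : EuclideanSpace ℝ (Fin d) → EuclideanSpace ℝ (Fin d) →ᵃ[ℝ] ℝ) : Prop where
  self : ∀ c ∈ C, g c c = 1
  of_ne : ∀ c ∈ C, ∀ c' ∈ C, c ≠ c' → g c c' = 0
  sum_eq_one : ∀ y, ∑ c ∈ C, g c y = 1
  sum_smul : ∀ y, ∑ c ∈ C, g c y • c = y
  pos : ∀ c ∈ C, 0 < g c z

/-- A vanishing coordinate would put `z` in the hull of `d` points, whereas general position
requires `d + 1`. -/
theorem InGeneralPosition.isContaining_of_affineIndependent (hz : InGeneralPosition z S)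
    {Y : Finset (EuclideanSpace ℝ (Fin d))} (hYS : Y ⊆ S) (hYc : Y.card = d + 1)
    (hY : AffineIndependent ℝ ((↑) : Y → EuclideanSpace ℝ (Fin d)))
    (hzY : z ∈ convexHull ℝ (Y : Set (EuclideanSpace ℝ (Fin d)))) :
    IsContaining z Y ∧ ∃ g, IsBarycentric z Y g := by
  classical
  have htop : affineSpan ℝ (Set.range ((↑) : Y → EuclideanSpace ℝ (Fin d))) = ⊤ := by
    rw [hY.affineSpan_eq_top_iff_card_eq_finrank_add_one]
    simp [hYc]
  let b : AffineBasis Y ℝ (EuclideanSpace ℝ (Fin d)) := ⟨(↑), hY, htop⟩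
  have hrange : Set.range b = (Y : Set (EuclideanSpace ℝ (Fin d))) := Subtype.range_coe
  have hnn : ∀ i, 0 ≤ b.coord i z := by
    rw [← hrange, b.convexHull_eq_nonneg_coord] at hzY
    exact hzY
  let g : EuclideanSpace ℝ (Fin d) → EuclideanSpace ℝ (Fin d) →ᵃ[ℝ] ℝ :=
    fun y => if h : y ∈ Y then b.coord ⟨y, h⟩ else 0
  have hg : ∀ i : Y, g i = b.coord i := fun i => by simp [g]
  have hsum : ∀ y, ∑ c ∈ Y, g c y = 1 := fun y => by
    rw [← Finset.sum_coe_sort]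
    simp only [hg]
    exact b.sum_coord_apply_eq_one y
  have hsmul : ∀ y, ∑ c ∈ Y, g c y • c = y := fun y => by
    rw [← Finset.sum_coe_sort]
    simp only [hg]
    exact b.linear_combination_coord_eq_self y
  have hpos : ∀ i, 0 < b.coord i z := by
    intro i
    refine lt_of_le_of_ne (hnn i) (fun h0 => ?_)
    have hi0 : g i z = 0 := by rw [hg, ← h0]
    have hmem : z ∈ convexHull ℝ ((Y.erase i : Finset _) : Set (EuclideanSpace ℝ (Fin d))) := by
      rw [Finset.mem_convexHull']
      refine ⟨fun c => g c z, fun y hy => ?_, ?_, ?_⟩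
      · have := hnn ⟨y, Finset.mem_of_mem_erase hy⟩
        rwa [← hg] at this
      · exact (Finset.sum_erase Y (f := fun c => g c z) hi0).trans (hsum z)
      · exact (Finset.sum_erase Y (f := fun c => g c z • c) (by simp [hi0])).trans (hsmul z)
    obtain ⟨Z, hZ, hZc, -⟩ := hz.exists_affineIndependent
      ((Finset.erase_subset _ _).trans hYS) hmem
    have h1 := Finset.card_le_card hZ
    have h2 := Finset.card_erase_add_one i.2
    omega
  refine ⟨?_, g, ?_, ?_, hsum, hsmul, ?_⟩
  · unfold IsContaining
    rw [← hrange, b.interior_convexHull]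
    exact hpos
  · intro c hc
    rw [hg ⟨c, hc⟩]
    exact b.coord_apply_eq ⟨c, hc⟩
  · intro c hc c' hc' hne
    rw [hg ⟨c, hc⟩]
    exact b.coord_apply_ne (j := ⟨c', hc'⟩) (by simpa using hne)
  · intro c hc
    rw [hg ⟨c, hc⟩]
    exact hpos _

theorem mem_minContaining {C : Finset (EuclideanSpace ℝ (Fin d))} :
    C ∈ minContaining z S ↔ C ⊆ S ∧ IsMinimalContaining z C := by
  simp [minContaining]

theorem mem_maxAvoiding {A : Finset (EuclideanSpace ℝ (Fin d))} :
    A ∈ maxAvoiding z S ↔ A ⊆ S ∧ IsMaximalAvoiding z S A := by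
  simp [maxAvoiding]

/-- Allows nonnegative weights alone to certify the result of a pivot. -/
theorem InGeneralPosition.mem_minContaining_of_card_le (hz : InGeneralPosition z S)
    {X : Finset (EuclideanSpace ℝ (Fin d))} (hX : X ⊆ S) (hXc : X.card ≤ d + 1)
    (hzX : z ∈ convexHull ℝ (X : Set (EuclideanSpace ℝ (Fin d)))) :
    X ∈ minContaining z S := by
  obtain ⟨Y, hYX, hYc, hY, hzY⟩ := hz.exists_affineIndependent hX hzX
  obtain rfl : Y = X := Finset.eq_of_subset_of_card_le hYX (by omega)
  refine mem_minContaining.2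
    ⟨hX, (hz.isContaining_of_affineIndependent hX hYc hY hzY).1, fun Z hZ hzZ => ?_⟩
  obtain ⟨W, hW, hWc, -⟩ := hz.exists_affineIndependent (hZ.1.trans hX) (interior_subset hzZ)
  have h1 := Finset.card_le_card hW
  have h2 := Finset.card_lt_card hZ
  omega

theorem InGeneralPosition.exists_mem_minContaining (hz : InGeneralPosition z S)
    {X : Finset (EuclideanSpace ℝ (Fin d))} (hX : X ⊆ S)
    (hzX : z ∈ convexHull ℝ (X : Set (EuclideanSpace ℝ (Fin d)))) :
    ∃ C ∈ minContaining z S, C ⊆ X := by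
  obtain ⟨Y, hYX, hYc, -, hzY⟩ := hz.exists_affineIndependent hX hzX
  exact ⟨Y, hz.mem_minContaining_of_card_le (hYX.trans hX) hYc.le hzY, hYX⟩

theorem InGeneralPosition.card_and_barycentric (hz : InGeneralPosition z S)
    {C : Finset (EuclideanSpace ℝ (Fin d))} (hC : C ∈ minContaining z S) :
    C.card = d + 1 ∧ ∃ g, IsBarycentric z C g := by
  obtain ⟨hCS, hC, hmin⟩ := mem_minContaining.1 hC
  obtain ⟨Y, hYC, hYc, hY, hzY⟩ := hz.exists_affineIndependent hCS (interior_subset hC)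
  obtain ⟨h1, h2⟩ := hz.isContaining_of_affineIndependent (hYC.trans hCS) hYc hY hzY
  rcases hYC.eq_or_ssubset with rfl | hss
  · exact ⟨hYc, h2⟩
  · exact absurd h1 (hmin Y hss)

theorem IsBarycentric.eq_weight {C : Finset (EuclideanSpace ℝ (Fin d))}
    {g : EuclideanSpace ℝ (Fin d) → EuclideanSpace ℝ (Fin d) →ᵃ[ℝ] ℝ}
    (hg : IsBarycentric z C g) {w : EuclideanSpace ℝ (Fin d) → ℝ} (hw : ∑ c ∈ C, w c = 1)
    (hwz : ∑ c ∈ C, w c • c = z) {x : EuclideanSpace ℝ (Fin d)} (hx : x ∈ C) :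
    g x z = w x := by
  rw [← hwz, map_sum_smul _ _ _ hw, Finset.sum_eq_single x, hg.self x hx, mul_one]
  · intro y hy hyx
    rw [hg.of_ne x hx y hy hyx.symm, mul_zero]
  · exact fun h => absurd hx h

/-! ### Pivoting and separating halfspaces -/

variable [DecidableEq (EuclideanSpace ℝ (Fin d))]

/-- The ratio test of the simplex method: `z` is `θ • a` plus the combination of `C` with weights `g
y z - θ * g y a`, and the least ratio `g c z / g c a` with `0 < g c a` keeps these nonnegative while
killing the weight of `c`. -/
theorem IsBarycentric.exists_pivot {C : Finset (EuclideanSpace ℝ (Fin d))}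
    {g : EuclideanSpace ℝ (Fin d) → EuclideanSpace ℝ (Fin d) →ᵃ[ℝ] ℝ}
    (hg : IsBarycentric z C g) {a : EuclideanSpace ℝ (Fin d)} (ha : a ∉ C) :
    ∃ c ∈ C, ∃ w : EuclideanSpace ℝ (Fin d) → ℝ,
      (∀ y ∈ insert a (C.erase c), 0 ≤ w y) ∧ ∑ y ∈ insert a (C.erase c), w y = 1 ∧
      ∑ y ∈ insert a (C.erase c), w y • y = z ∧
      ∃ θ > 0, ∀ y ∈ C, w y = g y z - θ * g y a := by
  have hne : (C.filter (fun c => 0 < g c a)).Nonempty := by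
    by_contra h
    rw [Finset.not_nonempty_iff_eq_empty, Finset.filter_eq_empty_iff] at h
    have h1 : ∑ c ∈ C, g c a ≤ 0 := Finset.sum_nonpos (fun c hc => not_lt.1 (h hc))
    rw [hg.sum_eq_one] at h1
    linarith
  obtain ⟨c, hc, hmin⟩ := Finset.exists_min_image _ (fun c => g c z / g c a) hne
  obtain ⟨hcC, hca⟩ := Finset.mem_filter.1 hc
  set θ := g c z / g c a with hθ
  have hθ0 : 0 < θ := div_pos (hg.pos c hcC) hca
  set w : EuclideanSpace ℝ (Fin d) → ℝ := fun y => if y = a then θ else g y z - θ * g y a with hw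
  have hwa : w a = θ := by simp [hw]
  have hwC : ∀ y ∈ C, w y = g y z - θ * g y a := by
    intro y hy
    have : y ≠ a := by rintro rfl; exact ha hy
    simp [hw, this]
  have hwc : w c = 0 := by
    rw [hwC c hcC, hθ]
    field_simp
    ring
  have haE : a ∉ C.erase c := fun h => ha (Finset.mem_of_mem_erase h)
  refine ⟨c, hcC, w, ?_, ?_, ?_, θ, hθ0, hwC⟩
  · intro y hy
    rcases Finset.mem_insert.1 hy with rfl | hy
    · rw [hwa]; exact hθ0.le
    · have hyC := Finset.mem_of_mem_erase hy
      rw [hwC y hyC, sub_nonneg]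
      by_cases hya : 0 < g y a
      · exact (le_div_iff₀ hya).1 (hmin y (Finset.mem_filter.2 ⟨hyC, hya⟩))
      · exact (mul_nonpos_of_nonneg_of_nonpos hθ0.le (not_lt.1 hya)).trans (hg.pos y hyC).le
  · rw [Finset.sum_insert haE, Finset.sum_erase _ hwc, hwa, Finset.sum_congr rfl hwC,
      Finset.sum_sub_distrib, ← Finset.mul_sum, hg.sum_eq_one, hg.sum_eq_one]
    ring
  · rw [Finset.sum_insert haE, Finset.sum_erase _ (by simp [hwc]), hwa,
      Finset.sum_congr rfl (fun y hy => by rw [hwC y hy])]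
    simp only [sub_smul, mul_smul]
    rw [Finset.sum_sub_distrib, ← Finset.smul_sum, hg.sum_smul, hg.sum_smul]
    abel

theorem InGeneralPosition.insert_erase_mem (hz : InGeneralPosition z S)
    {C : Finset (EuclideanSpace ℝ (Fin d))} (hC : C ∈ minContaining z S)
    {a c : EuclideanSpace ℝ (Fin d)} (ha : a ∈ S) (hc : c ∈ C)
    {w : EuclideanSpace ℝ (Fin d) → ℝ} (hw0 : ∀ y ∈ insert a (C.erase c), 0 ≤ w y)
    (hw1 : ∑ y ∈ insert a (C.erase c), w y = 1)
    (hwz : ∑ y ∈ insert a (C.erase c), w y • y = z) :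
    insert a (C.erase c) ∈ minContaining z S := by
  refine hz.mem_minContaining_of_card_le
    (Finset.insert_subset ha ((Finset.erase_subset _ _).trans (mem_minContaining.1 hC).1)) ?_
    (Finset.mem_convexHull'.2 ⟨w, hw0, hw1, hwz⟩)
  rw [← (hz.card_and_barycentric hC).1, ← Finset.card_erase_add_one hc]
  exact Finset.card_insert_le _ _

theorem InGeneralPosition.pivotFamily (hz : InGeneralPosition z S) :
    PivotFamily S d (minContaining z S) where
  subset C hC := (mem_minContaining.1 hC).1
  card_eq C hC := (hz.card_and_barycentric hC).1
  exchange C hC x hx hxC := by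
    obtain ⟨-, g, hg⟩ := hz.card_and_barycentric hC
    obtain ⟨c, hc, w, hw0, hw1, hwz, -⟩ := hg.exists_pivot hxC
    exact ⟨c, hc, hz.insert_erase_mem hC hx hc hw0 hw1 hwz⟩
  star T hTS D hDT hDc hD C hC hCT := by
    intro a haD
    by_contra haC
    obtain ⟨hCc, gC, hgC⟩ := hz.card_and_barycentric hC
    obtain ⟨y₀, hy₀C, hy₀D⟩ : ∃ y ∈ C, y ∉ D := by
      by_contra! h
      have := Finset.card_le_card (show C ⊆ D from h)
      omega
    obtain ⟨-, g, hg⟩ := hz.card_and_barycentric (hD y₀ (hCT hy₀C) hy₀D)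
    have haI : a ∈ insert y₀ D := Finset.mem_insert_of_mem haD
    have hyI : y₀ ∈ insert y₀ D := Finset.mem_insert_self _ _
    have hay : a ≠ y₀ := by rintro rfl; exact hy₀D haD
    have hpa := hg.pos a haI
    have hpy := hg.pos y₀ hyI
    -- `h` vanishes at `z` and on `D` without `a`, and is positive at `a`. Each simplex `insert y D`
    -- around `z` forces `h y < 0`, so a simplex in `T` missing `a` would give `h z < 0`.
    set h : EuclideanSpace ℝ (Fin d) →ᵃ[ℝ] ℝ := g y₀ z • g a - g a z • g y₀ with hh
    have hap : ∀ y, h y = g y₀ z * g a y - g a z * g y₀ y := fun y => by simp [hh]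
    have hhz : h z = 0 := by rw [hap]; ring
    have hha : 0 < h a := by
      rw [hap, hg.self a haI, hg.of_ne y₀ hyI a haI hay.symm]; linarith
    have hhb : ∀ b ∈ D, b ≠ a → h b = 0 := by
      intro b hb hba
      have hbI : b ∈ insert y₀ D := Finset.mem_insert_of_mem hb
      rw [hap, hg.of_ne a haI b hbI hba.symm, hg.of_ne y₀ hyI b hbI
        (by rintro rfl; exact hy₀D hb)]
      ring
    have hneg : ∀ y ∈ T, y ∉ D → h y < 0 := by
      intro y hyT hyD
      obtain ⟨-, g', hg'⟩ := hz.card_and_barycentric (hD y hyT hyD)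
      have h1 := map_sum_smul h (insert y D) (fun c => g' c z) (hg'.sum_eq_one z)
      rw [hg'.sum_smul, hhz, Finset.sum_insert hyD, Finset.sum_eq_single a] at h1
      · have h2 := mul_pos (hg'.pos a (Finset.mem_insert_of_mem haD)) hha
        have h3 := hg'.pos y (Finset.mem_insert_self _ _)
        by_contra hcon
        have := mul_nonneg h3.le (not_lt.1 hcon)
        linarith
      · intro b hb hba
        rw [hhb b hb hba, mul_zero]
      · exact fun h => absurd haD h
    have h1 := map_sum_smul h C (fun c => gC c z) (hgC.sum_eq_one z)
    rw [hgC.sum_smul, hhz] at h1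
    have h2 : ∑ c ∈ C, gC c z * h c < 0 := by
      refine Finset.sum_neg' (fun c hc => ?_) ⟨y₀, hy₀C, ?_⟩
      · refine mul_nonpos_of_nonneg_of_nonpos (hgC.pos c hc).le ?_
        by_cases hcD : c ∈ D
        · exact (hhb c hcD (by rintro rfl; exact haC hc)).le
        · exact (hneg c (hCT hc) hcD).le
      · exact mul_neg_of_pos_of_neg (hgC.pos y₀ hy₀C) (hneg y₀ (hCT hy₀C) hy₀D)
    linarith

/-- Choose the simplex in `insert x A` minimizing the coordinate of `z` at `x`. If that coordinate
function were positive at some `a ∈ A`, pivoting `a` in would lower the minimum. -/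
theorem InGeneralPosition.exists_separating (hz : InGeneralPosition z S)
    {G : Finset (EuclideanSpace ℝ (Fin d)) → EuclideanSpace ℝ (Fin d) →
      EuclideanSpace ℝ (Fin d) →ᵃ[ℝ] ℝ}
    (hG : ∀ C ∈ minContaining z S, IsBarycentric z C (G C))
    {A : Finset (EuclideanSpace ℝ (Fin d))} (hA : A ∈ maxAvoiding z S)
    {x : EuclideanSpace ℝ (Fin d)} (hx : x ∈ S) (hxA : x ∉ A) :
    ∃ C ∈ minContaining z S, x ∈ C ∧ C ⊆ insert x A ∧ ∀ a ∈ A, G C x a ≤ 0 := by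
  obtain ⟨hAS, -, hAav, hAmax⟩ := mem_maxAvoiding.1 hA
  have hnot : ∀ C ∈ minContaining z S, ¬ C ⊆ A := fun C hC hCA =>
    hAav ((mem_minContaining.1 hC).2.1.mono hCA)
  have hmem : ∀ C ∈ minContaining z S, C ⊆ insert x A → x ∈ C := by
    intro C hC hCA
    by_contra hxC
    exact hnot C hC ((Finset.subset_insert_iff_of_notMem hxC).1 hCA)
  have hne : ((minContaining z S).filter (fun C => C ⊆ insert x A)).Nonempty := by
    have hI : insert x A ⊆ S := Finset.insert_subset hx hAS
    have := hAmax (insert x A) hI (Finset.ssubset_insert hxA)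
    obtain ⟨C, hC, hCA⟩ := hz.exists_mem_minContaining hI (interior_subset (not_not.1 this))
    exact ⟨C, Finset.mem_filter.2 ⟨hC, hCA⟩⟩
  obtain ⟨C, hCf, hmin⟩ := Finset.exists_min_image _ (fun C => G C x z) hne
  obtain ⟨hC, hCA⟩ := Finset.mem_filter.1 hCf
  have hxC := hmem C hC hCA
  refine ⟨C, hC, hxC, hCA, fun a ha => ?_⟩
  by_contra! hpos
  have hax : a ≠ x := by rintro rfl; exact hxA ha
  have haC : a ∉ C := by
    intro haC
    rw [(hG C hC).of_ne x hxC a haC hax.symm] at hpos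
    exact lt_irrefl _ hpos
  obtain ⟨c, hc, w, hw0, hw1, hwz, θ, hθ, hw⟩ := (hG C hC).exists_pivot haC
  have hE := hz.insert_erase_mem hC (hAS ha) hc hw0 hw1 hwz
  have hEA : insert a (C.erase c) ⊆ insert x A :=
    Finset.insert_subset (Finset.mem_insert_of_mem ha) ((Finset.erase_subset _ _).trans hCA)
  have h1 := hmin _ (Finset.mem_filter.2 ⟨hE, hEA⟩)
  rw [(hG _ hE).eq_weight hw1 hwz (hmem _ hE hEA), hw x hxC] at h1
  have := mul_pos hθ hpos
  linarith

theorem InGeneralPosition.exists_maximalAvoiders (hz : InGeneralPosition z S) :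
    ∃ φ, PivotFamily.MaximalAvoiders S (minContaining z S) (maxAvoiding z S) φ := by
  have hex : ∀ C, ∃ g, C ∈ minContaining z S → IsBarycentric z C g := by
    intro C
    by_cases hC : C ∈ minContaining z S
    · obtain ⟨-, g, hg⟩ := hz.card_and_barycentric hC
      exact ⟨g, fun _ => hg⟩
    · exact ⟨0, fun h => absurd h hC⟩
  choose G hG using hex
  have hφ : ∀ A x, ∃ C, A ∈ maxAvoiding z S → x ∈ S → x ∉ A →
      C ∈ minContaining z S ∧ x ∈ C ∧ C ⊆ insert x A ∧ ∀ a ∈ A, G C x a ≤ 0 := by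
    intro A x
    by_cases h : A ∈ maxAvoiding z S ∧ x ∈ S ∧ x ∉ A
    · obtain ⟨C, hC⟩ := hz.exists_separating hG h.1 h.2.1 h.2.2
      exact ⟨C, fun _ _ _ => hC⟩
    · exact ⟨∅, fun h1 h2 h3 => absurd ⟨h1, h2, h3⟩ h⟩
  choose φ hφ using hφ
  have hmax : ∀ A ∈ maxAvoiding z S, ∀ X ⊆ S, (∀ C ∈ minContaining z S, ¬ C ⊆ X) → A ⊆ X →
      A = X := by
    intro A hA X hX hav hAX
    obtain ⟨-, -, -, hAmax⟩ := mem_maxAvoiding.1 hA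
    rcases hAX.eq_or_ssubset with h | h
    · exact h
    · obtain ⟨C, hC, hCX⟩ := hz.exists_mem_minContaining hX
        (interior_subset (not_not.1 (hAmax X hX h)))
      exact absurd hCX (hav C hC)
  refine ⟨φ, fun A hA => (mem_maxAvoiding.1 hA).1, fun A hA C hC hCA => ?_, hmax,
    fun A hA x hx hxA => (hφ A x hA hx hxA).1, fun A hA x hx hxA => (hφ A x hA hx hxA).2.1,
    fun A hA x hx hxA => (hφ A x hA hx hxA).2.2.1, ?_⟩
  · exact (mem_maxAvoiding.1 hA).2.2.1 ((mem_minContaining.1 hC).2.1.mono hCA)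
  · intro A hA A' hA' x hx hxA hxA' he
    obtain ⟨hC, hxC, -, hneg⟩ := hφ A x hA hx hxA
    obtain ⟨-, -, -, hneg'⟩ := hφ A' x hA' hx hxA'
    rw [← he] at hneg'
    have hU : A ∪ A' ⊆ S := Finset.union_subset (mem_maxAvoiding.1 hA).1 (mem_maxAvoiding.1 hA').1
    -- The common coordinate function is nonpositive on `A ∪ A'` but positive at `z`, which is a
    -- convex combination of `E`.
    have hav : ∀ E ∈ minContaining z S, ¬ E ⊆ A ∪ A' := by
      intro E hE hEU
      have h1 := map_sum_smul (G (φ A x) x) E (fun c => G E c z) ((hG E hE).sum_eq_one z)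
      rw [(hG E hE).sum_smul] at h1
      have h2 := (hG _ hC).pos x hxC
      have h3 : ∑ c ∈ E, G E c z * G (φ A x) x c ≤ 0 := by
        refine Finset.sum_nonpos (fun c hc => ?_)
        refine mul_nonpos_of_nonneg_of_nonpos ((hG E hE).pos c hc).le ?_
        rcases Finset.mem_union.1 (hEU hc) with h | h
        · exact hneg c h
        · exact hneg' c h
      linarith
    exact (hmax A hA _ hU hav Finset.subset_union_left).trans
      (hmax A' hA' _ hU hav Finset.subset_union_right).symm

end Geometry

end ContainAvoid

theorem mainTheorem1 (d : ℕ) (S : Finset (EuclideanSpace ℝ (Fin d)))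
    (z : EuclideanSpace ℝ (Fin d)) (hzS : z ∉ S)
    (hS : ContainAvoid.IsContaining z S)
    (hz : ContainAvoid.InGeneralPosition z S)
    (hcard : d + 2 ≤ S.card) :
    ((ContainAvoid.maxAvoiding z S).card : ℤ) ≤
      (d : ℤ) * ((ContainAvoid.minContaining z S).card : ℤ) - (S.card : ℤ) + 3 := by
  classical
  obtain ⟨φ, hφ⟩ := hz.exists_maximalAvoiders
  obtain ⟨C, hC, -⟩ := hz.exists_mem_minContaining subset_rfl (interior_subset hS)
  refine hz.pivotFamily.card_maximalAvoiders_le ⟨C, hC⟩ ?_ hcard hφ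
  rw [Nat.one_le_iff_ne_zero]
  -- `ℝ⁰` is a single point, so it cannot contain `d + 2` points of `S`.
  rintro rfl
  have := Finset.card_le_one_of_subsingleton S
  omega
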